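/- Let $d\ge 1$ and let $R_d=\mathbb Z[u_1^{\pm1},\dots,u_d^{\pm1}]$; write $u^{\mathbf n}=u_1^{n_1}\cdots u_d^{n_d}$ for $\mathbf n\in\mathbb Z^d$. For an $R_d$-module $M$ let $X_M=\widehat M$ be the compact Pontryagin dual of the discrete abelian group $M$, and let $\alpha_M$ be the $\mathbb Z^d$-action on $X_M$ for which $\alpha_M^{\mathbf n}$ is the automorphism dual to multiplication by $u^{\mathbf n}$ on $M$. If $M$ is Noetherian then $X_M$ is metrizable. Let $\beta$ be a $\mathbb Z^d$-action by homeomorphisms of a compact metric space $(X,\rho)$. For $F\subset\mathbb R^d$ put $\rho_\beta^F(x,y)=\sup\{\rho(\beta^{\mathbf n}x,\beta^{\mathbf n}y):\mathbf n\in F\cap\mathbb Z^d\}$ (and $0$ if $F\cap\mathbb Z^d=\emptyset$), and for $t>0$ let $F^t$ be the set of points of $\mathbb R^d$ at Euclidean distance at most $t$ from $F$. Then $\beta$ is *expansive along $F$* if there are $\varepsilon>0$ and $t>0$ such that $\rho_\beta^{F^t}(x,y)\le\varepsilon$ implies $x=y$. A half-space is a set $H=\{\mathbf x\in\mathbb R^d:\mathbf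 x\cdot\mathbf v_H\le 0\}$ with $\mathbf v_H$ a unit vector (its outward unit normal). Put $R_H=\mathbb Z[u^{\mathbf n}:\mathbf n\in H\cap\mathbb Z^d]\subset R_d$. For an ideal $\mathfrak a$ of $R_d$ let $$\mathsf V(\mathfrak a)=\{\mathbf z\in(\mathbb C\smallsetminus\{0\})^d: f(\mathbf z)=0\text{ for all }f\in\mathfrak a\},\qquad \log|\mathsf V(\mathfrak a)|=\{(\log|z_1|,\dots,\log|z_d|):\mathbf z\in\mathsf V(\mathfrak a)\}.$$ Let $\operatorname{asc}(M)$ be the set of prime ideals of $R_d$ of the form $\{f\in R_d: f\cdot m=0\}$ with $m\in M$. **Theorem.** Let $M$ be a Noetherian $R_d$-module and let $H$ be a half-space in $\mathbb R^d$ with outward unit normal $\mathbf v_H$. Fix any metrics inducing the topologies of $X_M$ and of $X_{R_d/\mathfrak p}$, for the prime ideals $\mathfrak p$ of $R_d$. Then the following are equivalent. 1. $\alpha_M$ is expansive along $H$. 2. $\alpha_{R_d/\mathfrak p}$ is expansive along $H$ for every $\mathfrak p\in\operatorname{asc}(M)$. 3. For every $\mathfrak p\in\operatorname{asc}(M)$,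 the $R_H$-module $R_d/\mathfrak p$ is Noetherian and $[0,\infty)\mathbf v_H\cap\log|\mathsf V(\mathfrak p)|=\emptyset$, where $[0,\infty)\mathbf v_H=\{t\mathbf v_H:t\ge0\}$. -/

import Mathlib

noncomputable section

namespace AlgAction

/-! ### Topological `ℤ^d`-actions and expansiveness along subsets of `ℝ^d` -/

/-- An action of `ℤ^d` by homeomorphisms of `X`. -/
abbrev ZAction (d : ℕ) (X : Type*) [TopologicalSpace X] : Type _ :=
  Multiplicative (Fin d → ℤ) →* (X ≃ₜ X)

/-- A metric on the topological space `X` that induces its topology. -/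
structure CompatibleMetric (X : Type*) [t : TopologicalSpace X] where
  /-- the metric -/
  metric : MetricSpace X
  compatible : metric.toUniformSpace.toTopologicalSpace = t

/-- The point of `ℝ^d` (Euclidean norm) given by an integer vector. -/
def toReal {d : ℕ} (n : Fin d → ℤ) : EuclideanSpace ℝ (Fin d) :=
  WithLp.toLp 2 fun j => (n j : ℝ)

/-- `ρ_β^F(x, y) = sup {ρ(β^n x, β^n y) : n ∈ F ∩ ℤ^d}`, which is `0` if `F ∩ ℤ^d = ∅`
(on a compact space this is a supremum of a bounded set of reals). -/
def supDist {d : ℕ} {X : Type*} [TopologicalSpace X] [CompactSpace X]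
    (ρ : CompatibleMetric X) (β : ZAction d X) (F : Set (EuclideanSpace ℝ (Fin d)))
    (x y : X) : ℝ :=
  ⨆ n : {n : Fin d → ℤ // toReal n ∈ F},
    ρ.metric.dist (β (Multiplicative.ofAdd n.1) x) (β (Multiplicative.ofAdd n.1) y)

/-- `β` is expansive along `F`: there are `ε > 0` and `t > 0` such that
`ρ_β^{F^t}(x, y) ≤ ε` implies `x = y`, where `F^t` is the closed `t`-thickening of `F`. -/
def IsExpansiveAlong {d : ℕ} {X : Type*} [TopologicalSpace X] [CompactSpace X]
    (ρ : CompatibleMetric X) (β : ZAction d X) (F : Set (EuclideanSpace ℝ (Fin d))) : Prop :=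
  ∃ ε > 0, ∃ t > 0, ∀ x y : X, supDist ρ β (Metric.cthickening t F) x y ≤ ε → x = y

/-- The half-space `H_v = {x : x · v ≤ 0}` with outward unit normal `v`. -/
def halfSpace {d : ℕ} (v : Metric.sphere (0 : EuclideanSpace ℝ (Fin d)) 1) :
    Set (EuclideanSpace ℝ (Fin d)) :=
  {x | inner ℝ x (v : EuclideanSpace ℝ (Fin d)) ≤ 0}

/-! ### Laurent polynomials -/

/-- `R_d = ℤ[u_1^{±1}, …, u_d^{±1}]`, as the group ring of `ℤ^d` over `ℤ`. -/
abbrev LaurentRing (d : ℕ) : Type := AddMonoidAlgebra ℤ (Fin d → ℤ)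

/-- The monomial `u^n`. -/
def monom {d : ℕ} (n : Fin d → ℤ) : LaurentRing d := AddMonoidAlgebra.single n 1

lemma monom_zero {d : ℕ} : (monom 0 : LaurentRing d) = 1 := rfl

lemma monom_add {d : ℕ} (m n : Fin d → ℤ) :
    (monom (m + n) : LaurentRing d) = monom m * monom n := by
  simp [monom, AddMonoidAlgebra.single_mul_single]

/-- `R_H = ℤ[u^n : n ∈ H ∩ ℤ^d]`, the subring of `R_d` generated by these monomials. -/
def halfRing {d : ℕ} (H : Set (EuclideanSpace ℝ (Fin d))) : Subalgebra ℤ (LaurentRing d) :=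
  Algebra.adjoin ℤ {f | ∃ n : Fin d → ℤ, toReal n ∈ H ∧ f = monom n}

/-- The value `f(z) = ∑ c_f(n) z_1^{n_1} ⋯ z_d^{n_d}` at a point `z` of `(ℂ^×)^d`. -/
def evalAt {d : ℕ} (z : Fin d → ℂˣ) (f : LaurentRing d) : ℂ :=
  f.coeff.sum fun n c => (c : ℂ) * ∏ j, (z j : ℂ) ^ n j

/-- `V(𝔞) ⊆ (ℂ^×)^d`. -/
def variety {d : ℕ} (a : Ideal (LaurentRing d)) : Set (Fin d → ℂˣ) :=
  {z | ∀ f ∈ a, evalAt z f = 0}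

/-- `log|z| = (log|z_1|, …, log|z_d|)`. -/
def logAbs {d : ℕ} (z : Fin d → ℂˣ) : EuclideanSpace ℝ (Fin d) :=
  WithLp.toLp 2 fun j => Real.log ‖(z j : ℂ)‖

/-- `log|V(𝔞)| = {log|z| : z ∈ V(𝔞)}`. -/
def logVariety {d : ℕ} (a : Ideal (LaurentRing d)) : Set (EuclideanSpace ℝ (Fin d)) :=
  logAbs '' variety a

/-- The ray `[0,∞)v = {t v : t ≥ 0}`. -/
def ray {d : ℕ} (v : EuclideanSpace ℝ (Fin d)) : Set (EuclideanSpace ℝ (Fin d)) :=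
  {x | ∃ t : ℝ, 0 ≤ t ∧ x = t • v}

/-! ### The algebraic action dual to a module -/

/-- The additive group `M`, written multiplicatively and given the discrete topology. -/
def DiscreteMul (M : Type*) : Type _ := Multiplicative M

instance (M : Type*) [AddCommGroup M] : CommGroup (DiscreteMul M) :=
  inferInstanceAs (CommGroup (Multiplicative M))

instance (M : Type*) : TopologicalSpace (DiscreteMul M) := ⊥

instance (M : Type*) : DiscreteTopology (DiscreteMul M) := ⟨rfl⟩

/-- `X_M`, the compact Pontryagin dual of the discrete abelian group `M`. -/
abbrev DualSpace (M : Type*) [AddCommGroup M] : Type _ := PontryaginDual (DiscreteMul M)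

/-- Multiplication by `u^n` on `M`, as a continuous endomorphism of the discrete group `M`. -/
def mulMonom {d : ℕ} (M : Type*) [AddCommGroup M] [Module (LaurentRing d) M]
    (n : Fin d → ℤ) : DiscreteMul M →ₜ* DiscreteMul M where
  toMonoidHom := AddMonoidHom.toMultiplicative
    (DistribSMul.toAddMonoidHom M (monom n : LaurentRing d))
  continuous_toFun := continuous_of_discreteTopology

lemma mulMonom_zero {d : ℕ} (M : Type*) [AddCommGroup M] [Module (LaurentRing d) M]
    (m : DiscreteMul M) : mulMonom M (0 : Fin d → ℤ) m = m :=
  one_smul (LaurentRing d) (Multiplicative.toAdd m)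

lemma mulMonom_add {d : ℕ} (M : Type*) [AddCommGroup M] [Module (LaurentRing d) M]
    (k n : Fin d → ℤ) (m : DiscreteMul M) :
    mulMonom M (k + n) m = mulMonom M k (mulMonom M n m) := by
  change (monom (k + n) : LaurentRing d) • (Multiplicative.toAdd m) =
    (monom k : LaurentRing d) • (monom n : LaurentRing d) • (Multiplicative.toAdd m)
  rw [monom_add, mul_smul]

/-- The automorphism `α_M^n` of `X_M`, dual to multiplication by `u^n` on `M`. -/
def dualHomeo {d : ℕ} (M : Type*) [AddCommGroup M] [Module (LaurentRing d) M]
    (n : Fin d → ℤ) : DualSpace M ≃ₜ DualSpace M where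
  toFun := PontryaginDual.map (mulMonom M n)
  invFun := PontryaginDual.map (mulMonom M (-n))
  left_inv x := by
    ext m
    simp only [PontryaginDual.map_apply, ← mulMonom_add, add_neg_cancel, mulMonom_zero]
  right_inv x := by
    ext m
    simp only [PontryaginDual.map_apply, ← mulMonom_add, neg_add_cancel, mulMonom_zero]
  continuous_toFun := (PontryaginDual.map (mulMonom M n)).continuous_toFun
  continuous_invFun := (PontryaginDual.map (mulMonom M (-n))).continuous_toFun

/-- The algebraic `ℤ^d`-action `α_M` on `X_M`. -/
def dualAction (d : ℕ) (M : Type*) [AddCommGroup M] [Module (LaurentRing d) M] :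
    ZAction d (DualSpace M) where
  toFun n := dualHomeo M (Multiplicative.toAdd n)
  map_one' := by
    refine Homeomorph.ext fun x => PontryaginDual.ext fun m => ?_
    exact congrArg x (mulMonom_zero (d := d) M m)
  map_mul' k n := by
    refine Homeomorph.ext fun x => PontryaginDual.ext fun m => ?_
    change x (mulMonom M (Multiplicative.toAdd k + Multiplicative.toAdd n) m) =
      x (mulMonom M (Multiplicative.toAdd n) (mulMonom M (Multiplicative.toAdd k) m))
    rw [add_comm, mulMonom_add]

/-- The duality pairing formula `⟨α_M^n x, m⟩ = ⟨x, u^n m⟩`. -/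
lemma dualAction_apply (d : ℕ) (M : Type*) [AddCommGroup M] [Module (LaurentRing d) M]
    (n : Fin d → ℤ) (x : DualSpace M) (m : M) :
    (dualAction d M (Multiplicative.ofAdd n) x) (Multiplicative.ofAdd m : Multiplicative M) =
      x (Multiplicative.ofAdd ((monom n : LaurentRing d) • m) : Multiplicative M) :=
  rfl

/-- Compatible metrics exist on `X_M` when `M` is a Noetherian `R_d`-module. -/
lemma nonempty_compatibleMetric (d : ℕ) (M : Type*) [AddCommGroup M]
    [Module (LaurentRing d) M] [IsNoetherian (LaurentRing d) M] :
    Nonempty (CompatibleMetric (DualSpace M)) := by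
  have hR : Countable (LaurentRing d) :=
    (AddMonoidAlgebra.coeffEquiv (R := ℤ) (M := Fin d → ℤ)).injective.countable
  obtain ⟨k, f, hf⟩ := Module.Finite.exists_fin' (LaurentRing d) M
  have hM : Countable (DiscreteMul M) := (hf.countable : Countable M)
  have hX : TopologicalSpace.MetrizableSpace (DualSpace M) :=
    (ContinuousMonoidHom.isEmbedding_toContinuousMap (DiscreteMul M) Circle).metrizableSpace
  exact ⟨⟨TopologicalSpace.metrizableSpaceMetric _, rfl⟩⟩

/-- The ring `R_d` is Noetherian. -/
instance (d : ℕ) : IsNoetherianRing (LaurentRing d) :=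
  Algebra.FiniteType.isNoetherianRing ℤ _

/-- `p` is associated to `M` iff it is a prime of the form `{f : f • m = 0}`. -/
lemma mem_associatedPrimes_iff (d : ℕ) (M : Type*) [AddCommGroup M]
    [Module (LaurentRing d) M] (p : Ideal (LaurentRing d)) :
    p ∈ associatedPrimes (LaurentRing d) M ↔
      p.IsPrime ∧ ∃ m : M, ∀ f, f ∈ p ↔ f • m = 0 := by
  rw [AssociatedPrimes.mem_iff, IsAssociatedPrime, Submodule.isAssociatedPrime_iff]
  simp only [SetLike.ext_iff, Submodule.mem_colon_singleton, Submodule.mem_bot]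

end AlgAction

end

noncomputable section

namespace AlgAction
open BoundedContinuousFunction

/-! ### Characters of a monoid from bounded functions satisfying linear recurrences -/

section Characters

variable (G : Type*) [AddCommMonoid G] [TopologicalSpace G] [DiscreteTopology G]

/-! By duality, expansiveness along H says that some neighbourhood of 1 in X_M contains no character
x ≠ 1 all of whose translates by H ∩ ℤ^d stay inside it; the thickening is absorbed by a translation
(`isExpansiveAlong_iff`). The core is `characterExpansive_iff`: this happens exactly when M is
Noetherian over R_H and the ray misses log|V(ann M)|.

Necessity. Let the finite set F ⊆ M define the neighbourhood. A character killing the R_H-span of F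
is trivial, so F generates M over R_H. A point z of V(ann M) with log|z| on the ray yields a nonzero
additive φ : M → ℂ on which u^n acts as z^n. Since |z^n| ≤ 1 for n in H, the character exp(i s Re
φ), suitably normalised and with s small, is nontrivial with small translates.

Sufficiency. Being Noetherian over R_H amounts to ann M containing some 1 - g with g supported
strictly inside H (`isNoetherian_halfRing_iff`). The principal arguments of a character with small
half-orbit form a bounded function on H ∩ ℤ^d that satisfies exact linear recurrences coming from
finitely many elements of ann M. If the function is nonzero, Gelfand theory
(`exists_bounded_character`) replaces it by a multiplicative χ with |χ| ≤ 1 satisfying the same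
recurrences. The relation 1 - g prevents χ from vanishing (`character_ne_zero`), so χ extends to n ↦
z^n with z in V(ann M), and |χ| ≤ 1 puts log|z| on the ray (`mem_ray_of_height_nonpos`).

Both conditions pass from ann M to the associated primes because the minimal primes over ann M are
associated. -/

/-- Translation operators on the bounded functions on `G`. -/
def translation : Multiplicative G →* ((G →ᵇ ℂ) →L[ℂ] (G →ᵇ ℂ)) where
  toFun n := LinearMap.mkContinuous
    { toFun := fun y => y.compContinuous ⟨fun k => k + n.toAdd, continuous_of_discreteTopology⟩
      map_add' := fun _ _ => rfl
      map_smul' := fun _ _ => rfl } 1 (by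
      intro y
      rw [one_mul]
      exact (norm_le (norm_nonneg y)).2 fun k => y.norm_coe_le_norm (k + n.toAdd))
  map_one' := by
    ext y k
    exact congrArg y (add_zero k)
  map_mul' m n := by
    ext y k
    change y (k + (m.toAdd + n.toAdd)) = y (k + m.toAdd + n.toAdd)
    rw [add_assoc]

lemma translation_apply (n : Multiplicative G) (y : G →ᵇ ℂ) (k : G) :
    translation G n y k = y (k + n.toAdd) := rfl

lemma norm_translation_le (n : Multiplicative G) : ‖translation G n‖ ≤ 1 :=
  ContinuousLinearMap.opNorm_le_bound _ zero_le_one fun y => by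
    rw [one_mul]
    exact (norm_le (norm_nonneg y)).2 fun k => y.norm_coe_le_norm (k + n.toAdd)

/-- The closed algebra of operators generated by the translations. -/
def translationAlgebra : Subalgebra ℂ ((G →ᵇ ℂ) →L[ℂ] (G →ᵇ ℂ)) :=
  (Algebra.adjoin ℂ (Set.range (translation G))).topologicalClosure

lemma translation_mem (n : Multiplicative G) : translation G n ∈ translationAlgebra G :=
  Subalgebra.le_topologicalClosure _ (Algebra.subset_adjoin ⟨n, rfl⟩)

/-- Translations commute, and commutativity passes to the generated algebra and its closure; Gelfand
theory needs this. -/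
instance : NormedCommRing (translationAlgebra G) :=
  { (inferInstance : NormedRing (translationAlgebra G)) with
    mul_comm := by
      have h : ∀ a ∈ Set.range (translation G), ∀ b ∈ Set.range (translation G),
          a * b = b * a := by
        rintro _ ⟨m, rfl⟩ _ ⟨n, rfl⟩
        rw [← map_mul, ← map_mul, mul_comm]
      exact (Subalgebra.commRingTopologicalClosure _
        (Algebra.isMulCommutative_adjoin ℂ h).is_comm.comm).mul_comm }

instance : CompleteSpace (translationAlgebra G) :=
  (Subalgebra.isClosed_topologicalClosure _).completeSpace_coe

end Characters

/-- The operators killing `y` form a proper ideal of the commutative Banach algebra generated by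
translations, and this ideal contains the operator of each `f ∈ S`. A maximal ideal above it is the
kernel of a Banach algebra character (Gelfand–Mazur); restricted to translations, which are
contractions, this is `χ`. As `G` is only a monoid, `χ` may take the value 0. -/
theorem exists_bounded_character {G : Type*} [AddCommMonoid G] (S : Set (AddMonoidAlgebra ℤ G))
    (y : G → ℂ) (C : ℝ) (hC : ∀ n, ‖y n‖ ≤ C) (hy : y ≠ 0)
    (hS : ∀ f ∈ S, ∀ n, (f.coeff.sum fun j c => (c : ℂ) * y (n + j)) = 0) :
    ∃ χ : Multiplicative G →* ℂ, (∀ n, ‖χ n‖ ≤ 1) ∧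
      ∀ f ∈ S, AddMonoidAlgebra.lift ℤ ℂ G χ f = 0 := by
  let : TopologicalSpace G := ⊥
  have : DiscreteTopology G := ⟨rfl⟩
  let Y : G →ᵇ ℂ := BoundedContinuousFunction.ofNormedAddCommGroupDiscrete y C hC
  have hY : Y ≠ 0 := fun h => hy (funext fun k => DFunLike.congr_fun h k)
  let A := translationAlgebra G
  let T : Multiplicative G →* A := (translation G).codRestrict A (translation_mem G)
  let I : Ideal A :=
    { carrier := {a | a.1 Y = 0}
      zero_mem' := rfl
      add_mem' := fun {a b} ha hb => by
        change a.1 Y + b.1 Y = 0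
        rw [show a.1 Y = 0 from ha, show b.1 Y = 0 from hb, add_zero]
      smul_mem' := fun c a ha => by
        change c.1 (a.1 Y) = 0
        rw [show a.1 Y = 0 from ha, map_zero] }
  have hI : I ≠ ⊤ := fun h => hY ((Ideal.eq_top_iff_one I).1 h)
  obtain ⟨J, hJ, hIJ⟩ := I.exists_le_maximal hI
  let φ := WeakDual.CharacterSpace.equivAlgHom J.toCharacterSpace
  refine ⟨(φ : A →* ℂ).comp T, fun n => ?_, fun f hf => ?_⟩
  · have : Nontrivial (G →ᵇ ℂ) := ⟨⟨Y, 0, hY⟩⟩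
    have : NormOneClass A := ⟨norm_one (α := (G →ᵇ ℂ) →L[ℂ] (G →ᵇ ℂ))⟩
    exact (AlgHom.norm_apply_le_self φ (T n)).trans (norm_translation_le G n)
  · have h1 : AddMonoidAlgebra.lift ℤ ℂ G ((φ : A →* ℂ).comp T) f =
        φ (AddMonoidAlgebra.lift ℤ A G T f) := by
      simp [AddMonoidAlgebra.lift_apply, Finsupp.sum, map_sum]
    rw [h1]
    apply J.toCharacterSpace_apply_eq_zero_of_mem
    apply hIJ
    change ((AddMonoidAlgebra.lift ℤ A G T f : A) : (G →ᵇ ℂ) →L[ℂ] (G →ᵇ ℂ)) Y = 0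
    ext k
    refine Eq.trans ?_ (hS f hf k)
    simp only [AddMonoidAlgebra.lift_apply, Finsupp.sum, AddSubmonoidClass.coe_finsetSum,
      _root_.sum_apply, BoundedContinuousFunction.coe_sum, Finset.sum_apply]
    refine Finset.sum_congr rfl fun j _ => ?_
    change ((f.coeff j) • translation G (.ofAdd j)) Y k = _
    simp [translation_apply, Y]

end AlgAction

namespace AlgAction

open Topology Filter

/-! ### Expansiveness along a half-space in terms of characters -/

lemma CompatibleMetric.continuous_dist {X : Type*} [t : TopologicalSpace X]
    (ρ : CompatibleMetric X) : Continuous fun q : X × X => ρ.metric.dist q.1 q.2 := by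
  obtain ⟨m, rfl⟩ := ρ
  let := m
  exact _root_.continuous_dist

lemma CompatibleMetric.dist_self {X : Type*} [TopologicalSpace X]
    (ρ : CompatibleMetric X) (x : X) : ρ.metric.dist x x = 0 :=
  ρ.metric.dist_self x

/-- On a compact space the neighbourhoods of the diagonal are exactly the entourages, so the choice
of metric is immaterial. -/
lemma CompatibleMetric.exists_forall_dist_le {X : Type*} [t : TopologicalSpace X] [CompactSpace X]
    (ρ : CompatibleMetric X) {s : Set (X × X)} (hs : s ∈ 𝓝ˢ (Set.diagonal X)) :
    ∃ ε > 0, ∀ x y, ρ.metric.dist x y ≤ ε → (x, y) ∈ s := by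
  obtain ⟨m, rfl⟩ := ρ
  let := m
  rw [nhdsSet_diagonal_eq_uniformity, Metric.mem_uniformity_dist] at hs
  obtain ⟨ε, hε, h⟩ := hs
  exact ⟨ε / 2, by positivity, fun x y hxy => h (lt_of_le_of_lt hxy (by linarith))⟩

section SupDist

variable {d : ℕ} {X : Type*} [TopologicalSpace X] [CompactSpace X]
  (ρ : CompatibleMetric X) (β : ZAction d X) (F : Set (EuclideanSpace ℝ (Fin d)))

lemma dist_le_supDist (x y : X) {n : Fin d → ℤ} (hn : toReal n ∈ F) :
    ρ.metric.dist (β (Multiplicative.ofAdd n) x) (β (Multiplicative.ofAdd n) y) ≤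
      supDist ρ β F x y := by
  -- Boundedness is needed because the real supremum of an unbounded family is 0 by convention.
  have h : BddAbove (Set.range fun n : {n : Fin d → ℤ // toReal n ∈ F} =>
      ρ.metric.dist (β (Multiplicative.ofAdd n.1) x) (β (Multiplicative.ofAdd n.1) y)) := by
    refine (isCompact_range ρ.continuous_dist).bddAbove.mono ?_
    rintro _ ⟨n, rfl⟩
    exact ⟨(_, _), rfl⟩
  exact le_ciSup h ⟨n, hn⟩

lemma supDist_le {x y : X} {ε : ℝ} (hε : 0 ≤ ε)
    (h : ∀ n : Fin d → ℤ, toReal n ∈ F →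
      ρ.metric.dist (β (Multiplicative.ofAdd n) x) (β (Multiplicative.ofAdd n) y) ≤ ε) :
    supDist ρ β F x y ≤ ε :=
  Real.iSup_le (fun n => h n.1 n.2) hε

end SupDist

variable {d : ℕ}

/-- The linear functional `n ↦ n · v` on `ℤ^d`. -/
def height (v : EuclideanSpace ℝ (Fin d)) : (Fin d → ℤ) →+ ℝ where
  toFun n := inner ℝ (toReal n) v
  map_zero' := by simp [toReal, PiLp.inner_apply]
  map_add' m n := by
    simp [toReal, PiLp.inner_apply, mul_add, Finset.sum_add_distrib]

lemma height_eq_sum (v : EuclideanSpace ℝ (Fin d)) (n : Fin d → ℤ) :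
    height v n = ∑ j, (n j : ℝ) * v j := by
  simp [height, toReal, PiLp.inner_apply, mul_comm]

lemma toReal_mem_halfSpace {v : Metric.sphere (0 : EuclideanSpace ℝ (Fin d)) 1}
    {n : Fin d → ℤ} : toReal n ∈ halfSpace v ↔ height (v : EuclideanSpace ℝ (Fin d)) n ≤ 0 :=
  Iff.rfl

lemma exists_lt_height {v : EuclideanSpace ℝ (Fin d)} (hv : v ≠ 0) (c : ℝ) :
    ∃ n, c < height v n := by
  obtain ⟨n, hn⟩ : ∃ n, 0 < height v n := by
    by_contra! h
    refine hv (PiLp.ext fun j => ?_)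
    have h1 := h (Pi.single j 1)
    have h2 := h (-Pi.single j 1)
    rw [map_neg] at h2
    have h3 : height v (Pi.single j 1) = v j := by
      simp [height_eq_sum, Pi.single_apply]
    change v j = 0
    linarith
  obtain ⟨N, hN⟩ := exists_nat_gt (c / height v n)
  refine ⟨N • n, ?_⟩
  rw [map_nsmul, nsmul_eq_mul]
  exact (div_lt_iff₀ hn).1 hN

/-- Some neighbourhood of the identity contains no nontrivial character whose translates by the
half-space `{n | n · v ≤ 0}` all lie in it; the neighbourhood is given by finitely many elements
of `M`. -/
def CharacterExpansive (M : Type*) [AddCommGroup M] [Module (LaurentRing d) M]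
    (v : EuclideanSpace ℝ (Fin d)) : Prop :=
  ∃ F : Finset M, ∃ δ > 0, ∀ x : DualSpace M,
    (∀ n : Fin d → ℤ, height v n ≤ 0 → ∀ m ∈ F,
      dist (x (Multiplicative.ofAdd ((monom n : LaurentRing d) • m) : Multiplicative M)) 1 < δ) →
    x = 1

section Dual

variable (M : Type*) [AddCommGroup M]

lemma isInducing_dualSpace_coe :
    IsInducing fun (x : DualSpace M) (m : M) => x (Multiplicative.ofAdd m : Multiplicative M) :=
  ContinuousMap.isHomeomorph_coe.isInducing.comp
    (ContinuousMonoidHom.isEmbedding_toContinuousMap (DiscreteMul M) Circle).isInducing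

lemma basicNhd_mem_nhds_one (F : Finset M) {δ : ℝ} (hδ : 0 < δ) :
    {x : DualSpace M | ∀ m ∈ F, dist (x (Multiplicative.ofAdd m : Multiplicative M)) 1 < δ} ∈
      𝓝 (1 : DualSpace M) := by
  have h : ∀ m ∈ F, ∀ᶠ x : DualSpace M in 𝓝 1,
      dist (x (Multiplicative.ofAdd m : Multiplicative M)) 1 < δ := fun m _ => by
    have h1 := ((continuous_apply m).comp (isInducing_dualSpace_coe M).continuous).tendsto 1
    exact h1.eventually (Metric.ball_mem_nhds _ hδ)
  exact (F.eventually_all).2 h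

lemma exists_basicNhd_subset {U : Set (DualSpace M)} (hU : U ∈ 𝓝 (1 : DualSpace M)) :
    ∃ F : Finset M, ∃ δ > 0, {x : DualSpace M |
      ∀ m ∈ F, dist (x (Multiplicative.ofAdd m : Multiplicative M)) 1 < δ} ⊆ U := by
  rw [(isInducing_dualSpace_coe M).nhds_eq_comap, nhds_pi, Filter.mem_comap] at hU
  obtain ⟨V, hV, hVU⟩ := hU
  obtain ⟨I, hI, W, hW, hWV⟩ := Filter.mem_pi.1 hV
  choose δ hδ hδW using fun m => Metric.mem_nhds_iff.1 (hW m)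
  obtain ⟨η, hη, hηδ⟩ : ∃ η > 0, ∀ m ∈ hI.toFinset, η ≤ δ m := by
    rcases hI.toFinset.eq_empty_or_nonempty with h | h
    · exact ⟨1, one_pos, by simp [h]⟩
    · obtain ⟨m, -, hm⟩ := hI.toFinset.exists_min_image δ h
      exact ⟨δ m, hδ m, hm⟩
  refine ⟨hI.toFinset, η, hη, fun x hx => hVU (hWV fun m hm => hδW m ?_)⟩
  exact (hx m (hI.mem_toFinset.2 hm)).trans_le (hηδ m (hI.mem_toFinset.2 hm))

end Dual

section

variable {M : Type*} [AddCommGroup M] [Module (LaurentRing d) M]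
  {v : Metric.sphere (0 : EuclideanSpace ℝ (Fin d)) 1} {ρ : CompatibleMetric (DualSpace M)}

lemma height_le_of_mem_cthickening {t : ℝ} {n : Fin d → ℤ}
    (hn : toReal n ∈ Metric.cthickening t (halfSpace v)) (ht : 0 < t) :
    height (v : EuclideanSpace ℝ (Fin d)) n ≤ t + 1 := by
  have h := Metric.cthickening_subset_thickening' (by linarith) (lt_add_one t) _ hn
  obtain ⟨h, hh, hd⟩ := Metric.mem_thickening_iff.1 h
  have hv : ‖(v : EuclideanSpace ℝ (Fin d))‖ = 1 := norm_eq_of_mem_sphere v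
  have h1 : inner ℝ (toReal n - h) (v : EuclideanSpace ℝ (Fin d)) ≤ dist (toReal n) h := by
    simpa [hv, dist_eq_norm] using real_inner_le_norm (toReal n - h) (v : EuclideanSpace ℝ (Fin d))
  rw [inner_sub_left] at h1
  have h2 : inner ℝ h (v : EuclideanSpace ℝ (Fin d)) ≤ 0 := hh
  change inner ℝ (toReal n) (v : EuclideanSpace ℝ (Fin d)) ≤ t + 1
  linarith

theorem CharacterExpansive.isExpansiveAlong
    (h : CharacterExpansive M (v : EuclideanSpace ℝ (Fin d))) :
    IsExpansiveAlong ρ (dualAction d M) (halfSpace v) := by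
  obtain ⟨F, δ, hδ, h⟩ := h
  have hs : {q : DualSpace M × DualSpace M | ∀ m ∈ F,
      dist ((q.1 / q.2) (Multiplicative.ofAdd m : Multiplicative M)) 1 < δ} ∈
        𝓝ˢ (Set.diagonal (DualSpace M)) := by
    rw [nhdsSet_diagonal, Filter.mem_iSup]
    intro x
    have hc : Continuous fun q : DualSpace M × DualSpace M => q.1 / q.2 := continuous_div'
    have := hc.tendsto (x, x)
    rw [div_self'] at this
    exact this (basicNhd_mem_nhds_one M F hδ)
  obtain ⟨ε, hε, hερ⟩ := ρ.exists_forall_dist_le hs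
  refine ⟨ε, hε, 1, one_pos, fun x y hxy => div_eq_one.1 (h _ fun n hn m hm => ?_)⟩
  exact hερ _ _ ((dist_le_supDist ρ _ _ x y
    (Metric.self_subset_cthickening _ (toReal_mem_halfSpace.2 hn))).trans hxy) m hm

theorem IsExpansiveAlong.characterExpansive
    (h : IsExpansiveAlong ρ (dualAction d M) (halfSpace v)) :
    CharacterExpansive M (v : EuclideanSpace ℝ (Fin d)) := by
  obtain ⟨ε, hε, t, ht, h⟩ := h
  have hU : {x : DualSpace M | ρ.metric.dist x 1 < ε} ∈ 𝓝 (1 : DualSpace M) := by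
    have hc : Continuous fun x : DualSpace M => ρ.metric.dist x 1 :=
      ρ.continuous_dist.comp (continuous_id.prodMk continuous_const)
    refine (isOpen_Iio.preimage hc).mem_nhds ?_
    change ρ.metric.dist 1 1 < ε
    rwa [ρ.dist_self]
  obtain ⟨F, δ, hδ, hF⟩ := exists_basicNhd_subset M hU
  have hv : (v : EuclideanSpace ℝ (Fin d)) ≠ 0 := by
    rw [← norm_pos_iff, norm_eq_of_mem_sphere v]
    exact one_pos
  -- Lattice points of the thickened half-space have height at most t + 1, so translation by -k
  -- carries them all into the half-space.
  obtain ⟨k, hk⟩ := exists_lt_height hv (t + 1)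
  refine ⟨F, δ, hδ, fun x hx => ?_⟩
  have key : dualAction d M (Multiplicative.ofAdd (-k)) x = 1 := by
    refine h _ _ (supDist_le _ _ _ hε.le fun n hn => ?_)
    have hn' := height_le_of_mem_cthickening hn ht
    refine (hF (a := dualAction d M _ (dualAction d M _ x)) fun m hm => ?_).le
    have := hx (n + -k) (by rw [map_add, map_neg]; linarith) m hm
    rwa [← dualAction_apply, ofAdd_add, map_mul] at this
  exact (dualAction d M (Multiplicative.ofAdd (-k))).injective key

theorem isExpansiveAlong_iff :
    IsExpansiveAlong ρ (dualAction d M) (halfSpace v) ↔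
      CharacterExpansive M (v : EuclideanSpace ℝ (Fin d)) :=
  ⟨fun h => h.characterExpansive, fun h => h.isExpansiveAlong⟩

end

end AlgAction

namespace AlgAction

/-! ### The height filtration and Noetherian modules over the ring of a half-space -/

section Height

variable {d : ℕ} (v : EuclideanSpace ℝ (Fin d))

/-- The Laurent polynomials supported on `{n | n · v ≤ c}`. -/
def heightLE (c : ℝ) : Submodule ℤ (LaurentRing d) :=
  Submodule.span ℤ {f | ∃ n : Fin d → ℤ, height v n ≤ c ∧ f = monom n}

variable {v}

lemma monom_mem_heightLE {c : ℝ} {n : Fin d → ℤ} (hn : height v n ≤ c) :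
    monom n ∈ heightLE v c :=
  Submodule.subset_span ⟨n, hn, rfl⟩

lemma heightLE_mono {a b : ℝ} (hab : a ≤ b) : heightLE v a ≤ heightLE v b :=
  Submodule.span_mono fun _ ⟨n, hn, h⟩ => ⟨n, hn.trans hab, h⟩

lemma one_mem_heightLE : (1 : LaurentRing d) ∈ heightLE v 0 :=
  monom_mem_heightLE (n := 0) (map_zero (height v)).le

lemma mul_mem_heightLE {a b : ℝ} {f g : LaurentRing d} (hf : f ∈ heightLE v a)
    (hg : g ∈ heightLE v b) : f * g ∈ heightLE v (a + b) := by
  have h : heightLE v a * heightLE v b ≤ heightLE v (a + b) := by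
    rw [heightLE, heightLE, Submodule.span_mul_span, Submodule.span_le]
    rintro _ ⟨_, ⟨m, hm, rfl⟩, _, ⟨n, hn, rfl⟩, rfl⟩
    change monom m * monom n ∈ heightLE v (a + b)
    rw [← monom_add]
    exact monom_mem_heightLE (by rw [map_add]; exact add_le_add hm hn)
  exact h (Submodule.mul_mem_mul hf hg)

lemma pow_mem_heightLE {c : ℝ} {f : LaurentRing d} (hf : f ∈ heightLE v c) (k : ℕ) :
    f ^ k ∈ heightLE v (k * c) := by
  induction k with
  | zero => simpa using one_mem_heightLE
  | succ k ih =>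
    rw [pow_succ]
    convert mul_mem_heightLE ih hf using 2
    push_cast
    ring

lemma span_monom : Submodule.span ℤ (Set.range (monom (d := d))) = ⊤ := by
  refine eq_top_iff.2 fun f _ => ?_
  induction f using AddMonoidAlgebra.induction_linear with
  | zero => exact zero_mem _
  | add f g hf hg => exact add_mem (hf trivial) (hg trivial)
  | single n c =>
    have : (AddMonoidAlgebra.single n c : LaurentRing d) = c • monom n := by
      simp [monom, AddMonoidAlgebra.smul_single]
    rw [this]
    exact Submodule.smul_mem _ _ (Submodule.subset_span ⟨n, rfl⟩)

lemma exists_mem_heightLE (f : LaurentRing d) : ∃ c, f ∈ heightLE v c := by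
  have hf : f ∈ Submodule.span ℤ (Set.range (monom (d := d))) := span_monom ▸ trivial
  induction hf using Submodule.span_induction with
  | mem x hx =>
    obtain ⟨n, rfl⟩ := hx
    exact ⟨_, monom_mem_heightLE le_rfl⟩
  | zero => exact ⟨0, zero_mem _⟩
  | add x y _ _ hx hy =>
    obtain ⟨a, ha⟩ := hx
    obtain ⟨b, hb⟩ := hy
    exact ⟨max a b, add_mem (heightLE_mono (le_max_left _ _) ha)
      (heightLE_mono (le_max_right _ _) hb)⟩
  | smul c x _ hx =>
    obtain ⟨a, ha⟩ := hx
    exact ⟨a, Submodule.smul_mem _ _ ha⟩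

lemma mem_halfRing_iff {v : Metric.sphere (0 : EuclideanSpace ℝ (Fin d)) 1}
    {f : LaurentRing d} :
    f ∈ halfRing (halfSpace v) ↔ f ∈ heightLE (v : EuclideanSpace ℝ (Fin d)) 0 := by
  constructor
  · intro hf
    induction hf using Algebra.adjoin_induction with
    | mem x hx =>
      obtain ⟨n, hn, rfl⟩ := hx
      exact monom_mem_heightLE hn
    | algebraMap r =>
      rw [Algebra.algebraMap_eq_smul_one]
      exact Submodule.smul_mem _ _ one_mem_heightLE
    | add x y _ _ hx hy => exact add_mem hx hy
    | mul x y _ _ hx hy => simpa using mul_mem_heightLE hx hy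
  · exact fun hf => Algebra.span_le_adjoin ℤ _ hf

variable (v) in
/-- Laurent polynomials of the form `1 - g` with `g` supported on a half-space
`{n | n · v ≤ c}` with `c < 0`. -/
def leadingOne : Submonoid (LaurentRing d) where
  carrier := {f | ∃ c < 0, 1 - f ∈ heightLE v c}
  one_mem' := ⟨-1, by norm_num, by simp⟩
  mul_mem' := by
    rintro f g ⟨a, ha, hf⟩ ⟨b, hb, hg⟩
    refine ⟨max a b, max_lt ha hb, ?_⟩
    have h : 1 - f * g = (1 - f) + (1 - g) - (1 - f) * (1 - g) := by ring
    rw [h]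
    refine sub_mem (add_mem (heightLE_mono (le_max_left _ _) hf)
      (heightLE_mono (le_max_right _ _) hg)) (heightLE_mono ?_ (mul_mem_heightLE hf hg))
    exact le_trans (by linarith) (le_max_left a b)

end Height

/-! ### Noetherian modules over R_H and annihilators of the form 1 - g -/

section Noetherian

variable {d : ℕ} {v : Metric.sphere (0 : EuclideanSpace ℝ (Fin d)) 1}
  {M : Type*} [AddCommGroup M] [Module (LaurentRing d) M]

/-- Since `f` kills `M`, the element `1 - f` acts as the identity; multiplying `r` by a high power
of it lowers the height until the product lies in R_H. Hence R_H-submodules are R_d-submodules. -/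
lemma smul_mem_of_leadingOne {f : LaurentRing d}
    (hf : f ∈ leadingOne (v : EuclideanSpace ℝ (Fin d)))
    (hfM : f ∈ Module.annihilator (LaurentRing d) M)
    (N : Submodule (halfRing (halfSpace v)) M) (r : LaurentRing d) {m : M} (hm : m ∈ N) :
    r • m ∈ N := by
  obtain ⟨c, hc, hg⟩ := hf
  obtain ⟨a, ha⟩ := exists_mem_heightLE (v := (v : EuclideanSpace ℝ (Fin d))) r
  obtain ⟨K, hK⟩ := exists_nat_gt (a / -c)
  have h1 : r * (1 - f) ^ K ∈ halfRing (halfSpace v) := by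
    rw [mem_halfRing_iff]
    refine heightLE_mono ?_ (mul_mem_heightLE ha (pow_mem_heightLE hg K))
    rw [div_lt_iff₀ (by linarith)] at hK
    linarith
  have h2 : (1 - f) ^ K • m = m := by
    induction K with
    | zero => simp
    | succ K ih =>
      have : (1 - f) • m = m := by
        rw [sub_smul, one_smul, Module.mem_annihilator.1 hfM, sub_zero]
      clear h1 hK ih
      induction K with
      | zero => simpa using this
      | succ K ih => rw [pow_succ, mul_smul, this, ih]
  have h3 : r • m = (⟨_, h1⟩ : halfRing (halfSpace v)) • m := by
    change r • m = (r * (1 - f) ^ K) • m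
    rw [mul_smul, h2]
  rw [h3]
  exact N.smul_mem _ hm

theorem isNoetherian_of_leadingOne [IsNoetherian (LaurentRing d) M] {f : LaurentRing d}
    (hf : f ∈ leadingOne (v : EuclideanSpace ℝ (Fin d)))
    (hfM : f ∈ Module.annihilator (LaurentRing d) M) :
    IsNoetherian (halfRing (halfSpace v)) M := by
  refine ⟨fun N => ?_⟩
  let N' : Submodule (LaurentRing d) M :=
    { N with smul_mem' := fun r _ hm => smul_mem_of_leadingOne hf hfM N r hm }
  obtain ⟨S, hS⟩ := IsNoetherian.noetherian N'
  refine ⟨S, le_antisymm (Submodule.span_le.2 fun m hm => ?_) fun m hm => ?_⟩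
  · have : m ∈ N' := hS ▸ Submodule.subset_span hm
    exact this
  · have hm' : m ∈ Submodule.span (LaurentRing d) (S : Set M) := hS ▸ hm
    clear hm
    induction hm' using Submodule.span_induction with
    | mem x hx => exact Submodule.subset_span hx
    | zero => exact zero_mem _
    | add x y _ _ hx hy => exact add_mem hx hy
    | smul r x _ hx => exact smul_mem_of_leadingOne hf hfM _ r hx

/-- Cayley–Hamilton: multiplication by a monomial u^k of positive height satisfies a monic equation
over R_H of degree r. Multiplying by u^(-rk) turns the leading term into 1 and gives the others
height at most -(k · v), which is negative. -/
theorem exists_leadingOne_of_finite [Module.Finite (halfRing (halfSpace v)) M] :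
    ∃ f ∈ leadingOne (v : EuclideanSpace ℝ (Fin d)),
      f ∈ Module.annihilator (LaurentRing d) M := by
  have hv : (v : EuclideanSpace ℝ (Fin d)) ≠ 0 := by
    rw [← norm_pos_iff, norm_eq_of_mem_sphere v]
    exact one_pos
  obtain ⟨k, hk⟩ := exists_lt_height hv 0
  obtain ⟨p, hp, hpk⟩ := Algebra.IsIntegral.isIntegral (R := halfRing (halfSpace v))
    (Algebra.lsmul (halfRing (halfSpace v)) (halfRing (halfSpace v)) M (monom k))
  rw [← Polynomial.aeval_def, Polynomial.aeval_algHom_apply] at hpk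
  set r := p.natDegree
  have hunit : (monom (-k) : LaurentRing d) ^ r * monom k ^ r = 1 := by
    rw [← mul_pow, ← monom_add, neg_add_cancel, monom_zero, one_pow]
  refine ⟨monom (-k) ^ r * Polynomial.aeval (monom k) p, ⟨-height _ k, by linarith, ?_⟩, ?_⟩
  · rw [Polynomial.aeval_eq_sum_range, Finset.sum_range_succ, hp.coeff_natDegree, one_smul,
      mul_add, hunit, sub_add_cancel_right, Finset.mul_sum]
    refine neg_mem (sum_mem fun i hi => ?_)
    have hi' : i + 1 ≤ r := Finset.mem_range.1 hi
    have h1 := mem_halfRing_iff.1 (p.coeff i).2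
    have h2 := pow_mem_heightLE
      (monom_mem_heightLE (le_refl (height (v : EuclideanSpace ℝ (Fin d)) k))) i
    have h3 := pow_mem_heightLE
      (monom_mem_heightLE (le_refl (height (v : EuclideanSpace ℝ (Fin d)) (-k)))) r
    refine heightLE_mono ?_ (mul_mem_heightLE h3 (mul_mem_heightLE h1 h2))
    have hi'' : (i : ℝ) + 1 ≤ r := by exact_mod_cast hi'
    rw [map_neg]
    nlinarith
  · refine Module.mem_annihilator.2 fun m => ?_
    rw [mul_smul]
    have := LinearMap.congr_fun hpk m
    change (Polynomial.aeval (monom k) p : LaurentRing d) • m = 0 at this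
    rw [this, smul_zero]

theorem isNoetherian_halfRing_iff [IsNoetherian (LaurentRing d) M] :
    IsNoetherian (halfRing (halfSpace v)) M ↔
      ∃ f ∈ leadingOne (v : EuclideanSpace ℝ (Fin d)),
        f ∈ Module.annihilator (LaurentRing d) M :=
  ⟨fun _ => exists_leadingOne_of_finite, fun ⟨_, h1, h2⟩ => isNoetherian_of_leadingOne h1 h2⟩

end Noetherian

end AlgAction

namespace AlgAction

open TensorProduct

/-! ### Characters attached to points of the variety of the annihilator -/

section Eval

variable {d : ℕ}

/-- The character `n ↦ z_1^{n_1} ⋯ z_d^{n_d}` of `ℤ^d`. -/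
def powChar (z : Fin d → ℂˣ) : Multiplicative (Fin d → ℤ) →* ℂ where
  toFun n := ∏ j, (z j : ℂ) ^ n.toAdd j
  map_one' := by simp
  map_mul' m n := by
    rw [← Finset.prod_mul_distrib]
    exact Finset.prod_congr rfl fun j _ => zpow_add₀ (z j).ne_zero _ _

/-- Evaluation of Laurent polynomials at a point of `(ℂ^×)^d`, as a ring homomorphism. -/
def evalHom (z : Fin d → ℂˣ) : LaurentRing d →ₐ[ℤ] ℂ :=
  AddMonoidAlgebra.lift ℤ ℂ (Fin d → ℤ) (powChar z)

lemma evalAt_eq_evalHom (z : Fin d → ℂˣ) (f : LaurentRing d) : evalAt z f = evalHom z f :=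
  (AddMonoidAlgebra.lift_apply' (powChar z) f).symm

lemma mem_variety_iff {z : Fin d → ℂˣ} {a : Ideal (LaurentRing d)} :
    z ∈ variety a ↔ a ≤ RingHom.ker (evalHom z) := by
  refine forall₂_congr fun f _ => ?_
  rw [evalAt_eq_evalHom, RingHom.mem_ker]

lemma evalHom_monom (z : Fin d → ℂˣ) (n : Fin d → ℤ) :
    evalHom z (monom n) = powChar z (Multiplicative.ofAdd n) := by
  simp [evalHom, monom]

lemma norm_powChar (z : Fin d → ℂˣ) (n : Fin d → ℤ) :
    ‖powChar z (Multiplicative.ofAdd n)‖ = Real.exp (height (logAbs z) n) := by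
  have h (j : Fin d) : 0 < ‖(z j : ℂ)‖ := norm_pos_iff.2 (z j).ne_zero
  rw [height_eq_sum, Real.exp_sum]
  change ‖∏ j, (z j : ℂ) ^ n j‖ = _
  rw [norm_prod]
  refine Finset.prod_congr rfl fun j _ => ?_
  change _ = Real.exp (n j * Real.log ‖(z j : ℂ)‖)
  rw [norm_zpow, mul_comm, Real.exp_mul, Real.exp_log (h j), Real.rpow_intCast]

lemma height_smul (t : ℝ) (v : EuclideanSpace ℝ (Fin d)) (n : Fin d → ℤ) :
    height (t • v) n = t * height v n :=
  inner_smul_right (toReal n) v t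

/-- The kernel q of evaluation at z contains ann M, so it lies in the support of the finite module M
and M ⊗ κ(q) ≠ 0. A linear functional there, followed by the embedding κ(q) → ℂ induced by
evaluation, gives φ. -/
lemma exists_semilinear_of_mem_variety {M : Type*} [AddCommGroup M] [Module (LaurentRing d) M]
    [IsNoetherian (LaurentRing d) M] {z : Fin d → ℂˣ}
    (hz : z ∈ variety (Module.annihilator (LaurentRing d) M)) :
    ∃ φ : M →+ ℂ, φ ≠ 0 ∧ ∀ (f : LaurentRing d) (m : M), φ (f • m) = evalHom z f * φ m := by
  let q : Ideal (LaurentRing d) := RingHom.ker (evalHom z)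
  have hq : q.IsPrime := RingHom.ker_isPrime _
  have hs : (⟨q, hq⟩ : PrimeSpectrum (LaurentRing d)) ∈ Module.support (LaurentRing d) M :=
    Module.mem_support_iff_of_finite.2 (mem_variety_iff.1 hz)
  rw [Module.mem_support_iff_nontrivial_residueField_tensorProduct] at hs
  let K := q.ResidueField
  change Nontrivial (K ⊗[LaurentRing d] M) at hs
  obtain ⟨t, ht⟩ := exists_ne (0 : K ⊗[LaurentRing d] M)
  obtain ⟨l, hl⟩ : ∃ l : Module.Dual K (K ⊗[LaurentRing d] M), l t ≠ 0 := by
    by_contra! h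
    exact ht ((Module.forall_dual_apply_eq_zero_iff K t).1 h)
  let i : K →+* ℂ := Ideal.ResidueField.lift q (evalHom z : LaurentRing d →+* ℂ) le_rfl
    fun f hf => by
      rw [Submonoid.mem_comap, IsUnit.mem_submonoid_iff, isUnit_iff_ne_zero]
      exact hf
  have hi (f : LaurentRing d) : i (algebraMap _ K f) = evalHom z f :=
    Ideal.ResidueField.lift_algebraMap _ _ _ _ _
  refine ⟨(i : K →+ ℂ).comp ((l.toAddMonoidHom).comp
    (TensorProduct.mk (LaurentRing d) K M 1).toAddMonoidHom), fun h => hl ?_, fun f m => ?_⟩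
  · have h1 (m : M) : l (1 ⊗ₜ m) = 0 :=
      (map_eq_zero i).1 (DFunLike.congr_fun h m)
    clear ht hl
    induction t with
    | zero => exact map_zero _
    | tmul k m =>
      rw [← mul_one k, ← smul_eq_mul, ← TensorProduct.smul_tmul', map_smul, h1, smul_zero]
    | add x y hx hy => rw [map_add, hx, hy, add_zero]
  · change i (l (1 ⊗ₜ (f • m))) = evalHom z f * i (l (1 ⊗ₜ m))
    rw [← hi, ← map_mul, ← smul_eq_mul, ← map_smul, TensorProduct.tmul_smul, algebraMap_smul]

end Eval

/-! ### Separating points of a discrete group from subgroups by characters -/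

section Characters

variable {M : Type*} [AddCommGroup M]

/-- The point of `X_M` given by a homomorphism from `M` to the circle group. -/
def dualPoint (φ : M →+ Additive Circle) : DualSpace M :=
  ({ toMonoidHom := AddMonoidHom.toMultiplicativeLeft φ
     continuous_toFun := continuous_of_discreteTopology } : DiscreteMul M →ₜ* Circle)

/-- The embedding of the rational circle into the unit circle. -/
def rationalCircle : AddCircle (1 : ℚ) →+ Additive Circle :=
  QuotientAddGroup.lift (AddSubgroup.zmultiples (1 : ℚ))
    { toFun := fun r => Additive.ofMul (AddCircle.toCircle ((r : ℝ) : AddCircle (1 : ℝ)))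
      map_zero' := by simp
      map_add' := fun r s => by
        rw [Rat.cast_add, AddCircle.coe_add, AddCircle.toCircle_add, ofMul_mul] }
    (by
      rw [AddSubgroup.zmultiples_le]
      change AddCircle.toCircle (((1 : ℚ) : ℝ) : AddCircle (1 : ℝ)) = 1
      rw [Rat.cast_one, AddCircle.coe_period, AddCircle.toCircle_zero])

lemma rationalCircle_injective : Function.Injective rationalCircle := by
  rw [injective_iff_map_eq_zero]
  intro r hr
  induction r using QuotientAddGroup.induction_on with | H r => ?_
  have h1 : AddCircle.toCircle ((r : ℝ) : AddCircle (1 : ℝ)) =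
      AddCircle.toCircle (0 : AddCircle (1 : ℝ)) := by
    rw [AddCircle.toCircle_zero]; exact hr
  have h2 := AddCircle.injective_toCircle one_ne_zero h1
  obtain ⟨n, hn⟩ := (AddCircle.coe_eq_zero_iff 1).1 h2
  refine (AddCircle.coe_eq_zero_iff 1).2 ⟨n, ?_⟩
  have : ((n • (1 : ℚ) : ℚ) : ℝ) = r := by simpa using hn
  exact_mod_cast this

/-- ℚ/ℤ-valued characters of the quotient by `N` separate its points, and ℚ/ℤ embeds in the circle.
-/
lemma exists_dualPoint_ne_one {N : AddSubgroup M} {m : M} (hm : m ∉ N) :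
    ∃ x : DualSpace M, (∀ k ∈ N, x (Multiplicative.ofAdd k : Multiplicative M) = 1) ∧
      x (Multiplicative.ofAdd m : Multiplicative M) ≠ 1 := by
  have h0 : (QuotientAddGroup.mk' N m) ≠ 0 := by
    simpa using hm
  obtain ⟨c, hc⟩ := CharacterModule.exists_character_apply_ne_zero_of_ne_zero h0
  let c' : (M ⧸ N) →+ AddCircle (1 : ℚ) := c
  refine ⟨dualPoint (rationalCircle.comp (c'.comp (QuotientAddGroup.mk' N))),
    fun k hk => ?_, fun h => hc ?_⟩
  · have : QuotientAddGroup.mk' N k = 0 := by simpa using hk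
    change (rationalCircle (c' (QuotientAddGroup.mk' N k))).toMul = 1
    rw [this, map_zero, map_zero, toMul_zero]
  · exact rationalCircle_injective (h.trans (map_zero rationalCircle).symm)

end Characters

/-! ### Necessity of the algebraic conditions -/

section Necessity

variable {d : ℕ} {M : Type*} [AddCommGroup M] [Module (LaurentRing d) M]

/-- If `F` failed to generate, a nontrivial character would kill its R_H-span, and its translates
would be exactly 1 on `F`. -/
theorem CharacterExpansive.finite {v : Metric.sphere (0 : EuclideanSpace ℝ (Fin d)) 1}
    (h : CharacterExpansive M (v : EuclideanSpace ℝ (Fin d))) :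
    Module.Finite (halfRing (halfSpace v)) M := by
  obtain ⟨F, δ, hδ, h⟩ := h
  refine ⟨F, eq_top_iff.2 fun m _ => ?_⟩
  by_contra hm
  obtain ⟨x, hx, hxm⟩ := exists_dualPoint_ne_one
    (N := (Submodule.span (halfRing (halfSpace v)) (F : Set M)).toAddSubgroup) hm
  refine hxm ?_
  rw [h x fun n hn k hk => ?_]
  · rfl
  · rw [hx, dist_self]
    · exact hδ
    · exact Submodule.smul_mem _ (⟨monom n, mem_halfRing_iff.2 (monom_mem_heightLE hn)⟩ :
        halfRing (halfSpace v)) (Submodule.subset_span hk)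

theorem CharacterExpansive.ray_inter_logVariety [IsNoetherian (LaurentRing d) M]
    {v : EuclideanSpace ℝ (Fin d)} (h : CharacterExpansive M v) :
    ray v ∩ logVariety (Module.annihilator (LaurentRing d) M) = ∅ := by
  rw [Set.eq_empty_iff_forall_notMem]
  rintro _ ⟨⟨t, ht, htz⟩, z, hz, rfl⟩
  obtain ⟨φ, hφ, hφz⟩ := exists_semilinear_of_mem_variety hz
  obtain ⟨F, δ, hδ, h⟩ := h
  obtain ⟨m₀, hm₀⟩ := DFunLike.ne_iff.1 hφ
  rw [AddMonoidHom.zero_apply] at hm₀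
  obtain ⟨η, hη, hexp⟩ : ∃ η > 0, ∀ θ : ℝ, |θ| < η → dist (Circle.exp θ) 1 < δ := by
    obtain ⟨η, hη, h⟩ :=
      Metric.continuousAt_iff.1 (Circle.exp.continuous.continuousAt (x := 0)) δ hδ
    exact ⟨η, hη, fun θ hθ => by simpa using h (x := θ) (by simpa using hθ)⟩
  -- Dividing by `φ m₀` makes `ψ m₀ = 1`, so the real part cannot vanish identically.
  let ψ : M → ℝ := fun m => (φ m / φ m₀).re
  have hψ (m m' : M) : ψ (m + m') = ψ m + ψ m' := by
    simp only [ψ, map_add, add_div, Complex.add_re]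
  have hψn {n : Fin d → ℤ} (hn : height v n ≤ 0) (m : M) :
      |ψ ((monom n : LaurentRing d) • m)| ≤ ‖φ m / φ m₀‖ := by
    refine (Complex.abs_re_le_norm _).trans ?_
    rw [hφz, mul_div_assoc, norm_mul, evalHom_monom, norm_powChar, htz, height_smul]
    refine mul_le_of_le_one_left (norm_nonneg _) (Real.exp_le_one_iff.2 ?_)
    exact mul_nonpos_of_nonneg_of_nonpos ht hn
  set B : ℝ := ∑ m ∈ F, ‖φ m / φ m₀‖
  have hB : 0 ≤ B := Finset.sum_nonneg fun _ _ => norm_nonneg _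
  -- The bound `s * B < η` keeps the translates small; `s ≤ 1` keeps s below π, so that e^(is) ≠ 1.
  obtain ⟨s, hs, hs1, hsB⟩ : ∃ s > 0, s ≤ 1 ∧ s * B < η := by
    refine ⟨min 1 (η / (B + 1)), by positivity, min_le_left _ _, ?_⟩
    calc min 1 (η / (B + 1)) * B ≤ η / (B + 1) * B := by gcongr; exact min_le_right _ _
      _ < η := by rw [div_mul_eq_mul_div, div_lt_iff₀ (by linarith)]; nlinarith
  let χ : M →+ Additive Circle :=
    { toFun := fun m => Additive.ofMul (Circle.exp (s * ψ m))
      map_zero' := by simp [ψ]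
      map_add' := fun m m' => by rw [hψ, mul_add, Circle.exp_add, ofMul_mul] }
  have hχ : dualPoint χ = 1 := by
    refine h _ fun n hn m hm => hexp _ ?_
    rw [abs_mul, abs_of_pos hs]
    refine lt_of_le_of_lt ?_ hsB
    gcongr
    exact (hψn hn m).trans (Finset.single_le_sum (f := fun m => ‖φ m / φ m₀‖)
      (fun _ _ => norm_nonneg _) hm)
  have h1 : Circle.exp s = Circle.exp 0 := by
    have := DFunLike.congr_fun hχ (Multiplicative.ofAdd m₀ : Multiplicative M)
    change Circle.exp (s * (φ m₀ / φ m₀).re) = 1 at this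
    rwa [div_self hm₀, Complex.one_re, mul_one, ← Circle.exp_zero] at this
  refine hs.ne' (Circle.invOn_arg_exp.1.injOn ?_ ?_ h1)
  · exact ⟨by linarith [Real.pi_pos], by linarith [Real.pi_gt_three]⟩
  · exact ⟨by linarith [Real.pi_pos], by linarith [Real.pi_gt_three]⟩

end Necessity

end AlgAction

namespace AlgAction

/-! ### From characters of a half-space to points of the variety -/

section Geometry

variable {d : ℕ}

/-- Rounding N x down to a lattice point changes each pairing by an amount bounded independently of
N. For large N the strict inequality against v survives rounding, and a positive pairing with w
would survive as well. -/
lemma inner_nonpos_of_height_nonpos {v w x : EuclideanSpace ℝ (Fin d)}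
    (h : ∀ n, height v n ≤ 0 → height w n ≤ 0) (hx : inner ℝ x v < 0) : inner ℝ x w ≤ 0 := by
  let n : ℕ → Fin d → ℤ := fun N j => ⌊N * x j⌋
  have hn (u : EuclideanSpace ℝ (Fin d)) (N : ℕ) :
      |height u (n N) - N * inner ℝ x u| ≤ ∑ j, |u j| := by
    have : height u (n N) - N * inner ℝ x u = ∑ j, ((⌊N * x j⌋ : ℝ) - N * x j) * u j := by
      rw [height_eq_sum, PiLp.inner_apply, Finset.mul_sum, ← Finset.sum_sub_distrib]
      refine Finset.sum_congr rfl fun j _ => ?_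
      simp only [n, RCLike.inner_apply, conj_trivial]
      ring
    rw [this]
    refine (Finset.abs_sum_le_sum_abs _ _).trans (Finset.sum_le_sum fun j _ => ?_)
    rw [abs_mul]
    refine mul_le_of_le_one_left (abs_nonneg _) ?_
    rw [abs_le]
    constructor <;> linarith [Int.floor_le (N * x j), Int.lt_floor_add_one (N * x j)]
  by_contra! hw
  obtain ⟨N₁, hN₁⟩ := exists_nat_gt ((∑ j, |v j|) / -inner ℝ x v)
  obtain ⟨N₂, hN₂⟩ := exists_nat_gt ((∑ j, |w j|) / inner ℝ x w)
  rw [div_lt_iff₀ (by linarith)] at hN₁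
  rw [div_lt_iff₀ hw] at hN₂
  have h1 : height v (n (N₁ + N₂)) ≤ 0 := by
    have := (abs_le.1 (hn v (N₁ + N₂))).2
    push_cast at this
    nlinarith [N₂.cast_nonneg (α := ℝ)]
  have h2 := h _ h1
  have := (abs_le.1 (hn w (N₁ + N₂))).1
  push_cast at this
  nlinarith [N₁.cast_nonneg (α := ℝ)]

/-- A vector whose associated functional is nonpositive on the lattice points of a half-space is a
nonnegative multiple of the outward normal. -/
theorem mem_ray_of_height_nonpos {v w : EuclideanSpace ℝ (Fin d)} (hv : ‖v‖ = 1)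
    (h : ∀ n, height v n ≤ 0 → height w n ≤ 0) : w ∈ ray v := by
  have hvv : inner ℝ v v = (1 : ℝ) := by rw [real_inner_self_eq_norm_sq, hv, one_pow]
  -- Passing to the closed half-space: subtracting a small multiple of v makes the inequality strict
  -- at a cost of at most ε.
  have h0 {x : EuclideanSpace ℝ (Fin d)} (hx : inner ℝ x v ≤ 0) : inner ℝ x w ≤ 0 := by
    have hw : 0 ≤ inner ℝ v w := by
      have := inner_nonpos_of_height_nonpos h (x := -v) (by rw [inner_neg_left, hvv]; norm_num)
      rw [inner_neg_left] at this
      linarith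
    refine le_of_forall_pos_le_add fun ε hε => ?_
    have h1 := inner_nonpos_of_height_nonpos h (x := x - (ε / (inner ℝ v w + 1)) • v) (by
      rw [inner_sub_left, real_inner_smul_left, hvv]
      have : 0 < ε / (inner ℝ v w + 1) := by positivity
      linarith)
    rw [inner_sub_left, real_inner_smul_left] at h1
    have h2 : ε / (inner ℝ v w + 1) * inner ℝ v w ≤ ε := by
      rw [div_mul_eq_mul_div, div_le_iff₀ (by linarith)]
      nlinarith
    linarith
  have hw : 0 ≤ inner ℝ v w := by
    have := h0 (x := -v) (by rw [inner_neg_left, hvv]; norm_num)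
    rw [inner_neg_left] at this
    linarith
  refine ⟨inner ℝ v w, hw, ?_⟩
  -- The component of w orthogonal to v lies in the closed half-space, and its pairing with w is its
  -- own squared norm; hence it vanishes.
  have horth : inner ℝ (w - (inner ℝ v w : ℝ) • v) v = 0 := by
    rw [inner_sub_left, real_inner_smul_left, hvv, mul_one, real_inner_comm, sub_self]
  have h3 := h0 horth.le
  rw [← sub_eq_zero, ← norm_eq_zero, ← sq_eq_zero_iff]
  refine le_antisymm ?_ (sq_nonneg _)
  rw [← real_inner_self_eq_norm_sq]
  conv_lhs => rw [inner_sub_right, real_inner_smul_right, horth]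
  linarith

end Geometry

/-! ### Extending characters of the half-space monoid to ℤ^d -/

section Extension

variable {d : ℕ} (v : EuclideanSpace ℝ (Fin d))

/-- The lattice points of the half-space `{x | x · v ≤ 0}`. -/
def halfLattice : AddSubmonoid (Fin d → ℤ) where
  carrier := {n | height v n ≤ 0}
  zero_mem' := (map_zero (height v)).le
  add_mem' {m n} hm hn := by
    change height v (m + n) ≤ 0
    rw [map_add]
    exact add_nonpos hm hn

/-- The inclusion of the monoid ring of the half-space lattice in the Laurent ring. -/
def halfInclusion : AddMonoidAlgebra ℤ (halfLattice v) →ₐ[ℤ] LaurentRing d :=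
  AddMonoidAlgebra.lift ℤ _ _
    { toFun := fun n => monom (n.toAdd : Fin d → ℤ)
      map_one' := monom_zero
      map_mul' := fun _ _ => monom_add _ _ }

variable {v}

lemma halfInclusion_single (n : halfLattice v) (c : ℤ) :
    halfInclusion v (AddMonoidAlgebra.single n c) = c • monom (n : Fin d → ℤ) :=
  AddMonoidAlgebra.lift_single _ _ _

lemma exists_halfInclusion_eq {c : ℝ} (hc : c ≤ 0) {f : LaurentRing d} (hf : f ∈ heightLE v c) :
    ∃ g ∈ Submodule.span ℤ {g : AddMonoidAlgebra ℤ (halfLattice v) |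
      ∃ j : halfLattice v, height v j ≤ c ∧ g = AddMonoidAlgebra.single j 1},
      halfInclusion v g = f := by
  induction hf using Submodule.span_induction with
  | mem f hf =>
    obtain ⟨n, hn, rfl⟩ := hf
    refine ⟨_, Submodule.subset_span ⟨⟨n, hn.trans hc⟩, hn, rfl⟩, ?_⟩
    rw [halfInclusion_single, one_smul]
  | zero => exact ⟨0, zero_mem _, map_zero _⟩
  | add f₁ f₂ _ _ h₁ h₂ =>
    obtain ⟨g₁, hg₁, rfl⟩ := h₁
    obtain ⟨g₂, hg₂, rfl⟩ := h₂
    exact ⟨g₁ + g₂, add_mem hg₁ hg₂, map_add _ _ _⟩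
  | smul r f _ h =>
    obtain ⟨g, hg, rfl⟩ := h
    exact ⟨r • g, Submodule.smul_mem _ _ hg, map_zsmul _ _ _⟩

lemma exists_powChar_eq_of_ne_zero (ψ : Multiplicative (Fin d → ℤ) →* ℂ) (hψ : ∀ n, ψ n ≠ 0) :
    ∃ z : Fin d → ℂˣ, powChar z = ψ := by
  refine ⟨fun j => Units.mk0 _ (hψ (Multiplicative.ofAdd (Pi.single j 1))),
    MonoidHom.ext fun n => ?_⟩
  have hn : n = ∏ j, Multiplicative.ofAdd (Pi.single j (1 : ℤ) : Fin d → ℤ) ^ n.toAdd j := by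
    change n.toAdd = ∑ j, n.toAdd j • (Pi.single j (1 : ℤ) : Fin d → ℤ)
    ext i
    simp [Pi.single_apply]
  conv_rhs => rw [hn, map_prod]
  simp only [map_zpow]
  rfl

/-- Every lattice vector is a difference of two half-lattice vectors, so a nowhere vanishing χ
extends by quotients. -/
lemma exists_powChar_extending (hv : v ≠ 0) (χ : Multiplicative (halfLattice v) →* ℂ)
    (hχ : ∀ n, χ n ≠ 0) :
    ∃ z : Fin d → ℂˣ, ∀ n : halfLattice v,
      powChar z (Multiplicative.ofAdd (n : Fin d → ℤ)) = χ (Multiplicative.ofAdd n) := by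
  have hdiff (n : Fin d → ℤ) : ∃ a b : halfLattice v, n + b = a := by
    obtain ⟨k, hk⟩ := exists_lt_height hv |height v n|
    have h1 := abs_nonneg (height v n)
    have h2 := le_abs_self (height v n)
    refine ⟨⟨n + -k, ?_⟩, ⟨-k, ?_⟩, rfl⟩
    · change height v (n + -k) ≤ 0
      rw [map_add, map_neg]
      linarith
    · change height v (-k) ≤ 0
      rw [map_neg]
      linarith
  choose a b hab using hdiff
  -- The quotient does not depend on how n is written as a difference; multiplicativity follows.
  have key {n : Fin d → ℤ} {p q : halfLattice v} (h : n + q = p) :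
      χ (.ofAdd (a n)) / χ (.ofAdd (b n)) = χ (.ofAdd p) / χ (.ofAdd q) := by
    rw [div_eq_div_iff (hχ _) (hχ _), ← map_mul χ, ← map_mul χ, ← ofAdd_add, ← ofAdd_add]
    congr 2
    refine Subtype.ext ?_
    push_cast
    rw [← h, ← hab]
    abel
  let ψ : Multiplicative (Fin d → ℤ) →* ℂ :=
    { toFun := fun n => χ (.ofAdd (a n.toAdd)) / χ (.ofAdd (b n.toAdd))
      map_one' := by
        rw [key (n := Multiplicative.toAdd 1) (p := 0) (q := 0) (by simp), div_self (hχ _)]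
      map_mul' := fun m n => by
        rw [key (n := (m * n).toAdd) (p := a m.toAdd + a n.toAdd) (q := b m.toAdd + b n.toAdd)
          (by rw [toAdd_mul]; push_cast; rw [← hab, ← hab]; abel), ofAdd_add, ofAdd_add, map_mul,
          map_mul, mul_div_mul_comm] }
  obtain ⟨z, hz⟩ := exists_powChar_eq_of_ne_zero ψ fun n => div_ne_zero (hχ _) (hχ _)
  refine ⟨z, fun n => ?_⟩
  rw [hz]
  change χ (.ofAdd (a n)) / χ (.ofAdd (b n)) = _
  rw [key (p := n) (q := 0) (by simp)]
  exact (congrArg _ (map_one χ)).trans (div_one _)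

/-- If χ(n) = 0, each j in the support range of g has a multiple N j in n + H, so χ(j)^N = 0 and
χ(j) = 0. Then χ kills g, and the relation for 1 - g reads 1 = 0. -/
lemma character_ne_zero {χ : Multiplicative (halfLattice v) →* ℂ} {c : ℝ} (hc : c < 0)
    {g : AddMonoidAlgebra ℤ (halfLattice v)}
    (hg : g ∈ Submodule.span ℤ {g : AddMonoidAlgebra ℤ (halfLattice v) |
      ∃ j : halfLattice v, height v j ≤ c ∧ g = AddMonoidAlgebra.single j 1})
    (h : AddMonoidAlgebra.lift ℤ ℂ _ χ (1 - g) = 0) (n : Multiplicative (halfLattice v)) :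
    χ n ≠ 0 := by
  intro hn
  have hj (j : halfLattice v) (hj : height v j ≤ c) : χ (.ofAdd j) = 0 := by
    -- As c < 0, this says N c < height of n, whence N j - n has nonpositive height.
    obtain ⟨N, hN⟩ := exists_nat_gt (height v n.toAdd / c)
    rw [div_lt_iff_of_neg hc] at hN
    have hk : height v (N • (j : Fin d → ℤ) - n.toAdd) ≤ 0 := by
      rw [map_sub, map_nsmul, nsmul_eq_mul]
      nlinarith [N.cast_nonneg (α := ℝ)]
    have h1 : (Multiplicative.ofAdd j) ^ N = n * Multiplicative.ofAdd ⟨_, hk⟩ := by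
      refine Subtype.ext ?_
      change N • (j : Fin d → ℤ) = n.toAdd + (N • (j : Fin d → ℤ) - n.toAdd)
      abel
    have h2 : χ (.ofAdd j) ^ N = 0 := by rw [← map_pow, h1, map_mul, hn, zero_mul]
    exact eq_zero_of_pow_eq_zero h2
  have hg0 : AddMonoidAlgebra.lift ℤ ℂ _ χ g = 0 := by
    clear h
    induction hg using Submodule.span_induction with
    | mem g hg =>
      obtain ⟨j, hjc, rfl⟩ := hg
      rw [AddMonoidAlgebra.lift_single, hj j hjc, smul_zero]
    | zero => exact map_zero _
    | add g₁ g₂ _ _ h₁ h₂ => rw [map_add, h₁, h₂, add_zero]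
    | smul r g _ h => rw [map_zsmul, h, smul_zero]
  rw [map_sub, map_one, hg0, sub_zero] at h
  exact one_ne_zero h

end Extension

end AlgAction

namespace AlgAction

/-! ### Sufficiency, and reduction to associated primes -/

section Sufficiency

variable {d : ℕ} {M : Type*} [AddCommGroup M] [Module (LaurentRing d) M]

lemma DualSpace.apply_zero (x : DualSpace M) :
    x (Multiplicative.ofAdd 0 : Multiplicative M) = 1 :=
  map_one x

lemma DualSpace.apply_add (x : DualSpace M) (m m' : M) :
    x (Multiplicative.ofAdd (m + m') : Multiplicative M) =
      x (Multiplicative.ofAdd m : Multiplicative M) *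
        x (Multiplicative.ofAdd m' : Multiplicative M) :=
  map_mul x _ _

lemma DualSpace.apply_zsmul (x : DualSpace M) (c : ℤ) (m : M) :
    x (Multiplicative.ofAdd (c • m) : Multiplicative M) =
      x (Multiplicative.ofAdd m : Multiplicative M) ^ c :=
  map_zpow x _ _

/-- Lift of a point of `X_M` along `m` to the real function of principal arguments. -/
def argAlong (x : DualSpace M) (m : M) (n : Fin d → ℤ) : ℝ :=
  Complex.arg (x (Multiplicative.ofAdd ((monom n : LaurentRing d) • m) : Multiplicative M))

lemma exp_argAlong (x : DualSpace M) (m : M) (n : Fin d → ℤ) :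
    Circle.exp (argAlong x m n) =
      x (Multiplicative.ofAdd ((monom n : LaurentRing d) • m) : Multiplicative M) :=
  Circle.exp_arg _

/-- Thus if `halfInclusion v f` kills `m`, the arguments satisfy the recurrence of `f` modulo 2π. -/
lemma exp_sum_argAlong {v : EuclideanSpace ℝ (Fin d)} (x : DualSpace M) (m : M)
    (f : AddMonoidAlgebra ℤ (halfLattice v)) (n : halfLattice v) :
    Circle.exp (f.coeff.sum fun j c => (c : ℝ) * argAlong x m ((n + j : halfLattice v) : Fin d → ℤ))
      = x (Multiplicative.ofAdd ((monom (n : Fin d → ℤ) : LaurentRing d) •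
        halfInclusion v f • m) : Multiplicative M) := by
  induction f using AddMonoidAlgebra.induction_linear with
  | zero =>
    rw [map_zero, zero_smul, smul_zero, DualSpace.apply_zero]
    simp
  | add f g hf hg =>
    rw [AddMonoidAlgebra.coeff_add, Finsupp.sum_add_index' (by simp)
      (fun j b c => by push_cast; ring), Circle.exp_add, hf, hg, map_add, add_smul, smul_add,
      DualSpace.apply_add]
  | single j c =>
    rw [AddMonoidAlgebra.coeff_single, Finsupp.sum_single_index (by simp), halfInclusion_single,
      ← zsmul_eq_mul, Circle.exp_zsmul, exp_argAlong, smul_assoc, smul_comm _ c, ← mul_smul,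
      ← monom_add, DualSpace.apply_zsmul]
    rfl

lemma exists_dist_one_lt_imp_abs_arg_lt {η : ℝ} (hη : 0 < η) :
    ∃ δ > 0, ∀ c : Circle, dist c 1 < δ → |Complex.arg c| < η := by
  have h1 : ContinuousAt (fun c : Circle => Complex.arg c) 1 :=
    (Complex.continuousAt_arg (by simp)).comp continuous_subtype_val.continuousAt
  obtain ⟨δ, hδ, h⟩ := Metric.continuousAt_iff.1 h1 η hη
  exact ⟨δ, hδ, fun c hc => by simpa using h hc⟩

lemma eq_zero_of_exp_eq_one {θ : ℝ} (h : Circle.exp θ = 1) (hθ : |θ| < Real.pi) : θ = 0 := by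
  rw [← Circle.exp_zero] at h
  have := abs_lt.1 hθ
  exact Circle.invOn_arg_exp.1.injOn ⟨this.1, this.2.le⟩
    ⟨by linarith [Real.pi_pos], Real.pi_pos.le⟩ h

lemma DualSpace.eq_one_of_span {v : Metric.sphere (0 : EuclideanSpace ℝ (Fin d)) 1}
    {F : Set M} (hF : Submodule.span (halfRing (halfSpace v)) F = ⊤) {x : DualSpace M}
    (hx : ∀ m ∈ F, ∀ n, height (v : EuclideanSpace ℝ (Fin d)) n ≤ 0 →
      x (Multiplicative.ofAdd ((monom n : LaurentRing d) • m) : Multiplicative M) = 1) :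
    x = 1 := by
  -- Requiring triviality on all of R_H m, not only at m, makes this set an R_H-submodule; r = 1
  -- recovers m.
  let K : Submodule (halfRing (halfSpace v)) M :=
    { carrier := {m | ∀ r ∈ heightLE (v : EuclideanSpace ℝ (Fin d)) 0,
        x (Multiplicative.ofAdd (r • m) : Multiplicative M) = 1}
      zero_mem' := fun r _ => by
        rw [smul_zero, DualSpace.apply_zero]
      add_mem' := fun {m m'} hm hm' r hr => by
        rw [smul_add, DualSpace.apply_add, hm r hr, hm' r hr, one_mul]
      smul_mem' := fun s m hm r hr => by
        have : r • s • m = (r * (s : LaurentRing d)) • m := (mul_smul r (s : LaurentRing d) m).symm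
        rw [this]
        exact hm _ (by simpa using mul_mem_heightLE hr (mem_halfRing_iff.1 s.2)) }
  have hK : K = ⊤ := by
    rw [eq_top_iff, ← hF, Submodule.span_le]
    intro m hm r hr
    induction hr using Submodule.span_induction with
    | mem r hr =>
      obtain ⟨n, hn, rfl⟩ := hr
      exact hx m hm n hn
    | zero =>
      rw [zero_smul, DualSpace.apply_zero]
    | add r s _ _ hr hs =>
      rw [add_smul, DualSpace.apply_add, hr, hs, one_mul]
    | smul c r _ hr =>
      rw [smul_assoc, DualSpace.apply_zsmul, hr, one_zpow]
  refine PontryaginDual.ext fun m => ?_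
  have hm : (Multiplicative.toAdd m : M) ∈ K := hK ▸ trivial
  have h1 := hm 1 one_mem_heightLE
  rw [one_smul] at h1
  exact h1

/-- Finitely many elements of the half-space monoid ring that cut out the variety of an ideal
meeting `leadingOne`, one of them of the form `1 - g`. -/
lemma exists_finset_halfInclusion {v : EuclideanSpace ℝ (Fin d)} (hv : v ≠ 0)
    {a : Ideal (LaurentRing d)} {f : LaurentRing d} (hf : f ∈ leadingOne v) (hfa : f ∈ a) :
    ∃ (S : Finset (AddMonoidAlgebra ℤ (halfLattice v))) (c : ℝ) (_ : c < 0),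
      (∀ g ∈ S, halfInclusion v g ∈ a) ∧
      (∃ g ∈ Submodule.span ℤ {g : AddMonoidAlgebra ℤ (halfLattice v) |
        ∃ j : halfLattice v, height v j ≤ c ∧ g = AddMonoidAlgebra.single j 1}, 1 - g ∈ S) ∧
      ∀ z : Fin d → ℂˣ, (∀ g ∈ S, evalHom z (halfInclusion v g) = 0) → z ∈ variety a := by
  classical
  obtain ⟨c, hc, hfc⟩ := hf
  obtain ⟨g, hg, hgf⟩ := exists_halfInclusion_eq hc.le hfc
  obtain ⟨T, hT⟩ := IsNoetherian.noetherian a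
  -- A monomial is a unit, so shifting each generator into R_H changes neither its membership in the
  -- ideal nor its zeros.
  have hshift (h : LaurentRing d) : ∃ (k : Fin d → ℤ) (g : AddMonoidAlgebra ℤ (halfLattice v)),
      halfInclusion v g = monom k * h := by
    obtain ⟨b, hb⟩ := exists_mem_heightLE (v := v) h
    obtain ⟨k, hk⟩ := exists_lt_height hv b
    have hk' : monom (-k) * h ∈ heightLE v 0 := by
      refine heightLE_mono ?_ (mul_mem_heightLE (monom_mem_heightLE le_rfl) hb)
      rw [map_neg]
      linarith
    obtain ⟨g, -, hg⟩ := exists_halfInclusion_eq le_rfl hk'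
    exact ⟨-k, g, hg⟩
  choose k s hs using hshift
  refine ⟨insert (1 - g) (T.image s), c, hc, ?_, ⟨g, hg, Finset.mem_insert_self _ _⟩, ?_⟩
  · intro g' hg'
    rcases Finset.mem_insert.1 hg' with rfl | hg'
    · rw [map_sub, map_one, hgf, sub_sub_cancel]
      exact hfa
    · obtain ⟨h, hh, rfl⟩ := Finset.mem_image.1 hg'
      rw [hs]
      exact a.mul_mem_left _ (hT ▸ Submodule.subset_span hh)
  · intro z hz
    rw [mem_variety_iff, ← hT]
    refine Submodule.span_le.2 fun h hh => RingHom.mem_ker.2 ?_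
    have h1 := hz (s h) (Finset.mem_insert_of_mem (Finset.mem_image_of_mem s hh))
    rw [hs, map_mul, evalHom_monom] at h1
    refine (mul_eq_zero.1 h1).resolve_left ?_
    exact norm_pos_iff.1 (norm_powChar z _ ▸ Real.exp_pos _)

theorem characterExpansive_of_ray_inter_logVariety [IsNoetherian (LaurentRing d) M]
    {v : Metric.sphere (0 : EuclideanSpace ℝ (Fin d)) 1}
    (hM : IsNoetherian (halfRing (halfSpace v)) M)
    (hV : ray (v : EuclideanSpace ℝ (Fin d)) ∩
      logVariety (Module.annihilator (LaurentRing d) M) = ∅) :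
    CharacterExpansive M (v : EuclideanSpace ℝ (Fin d)) := by
  obtain ⟨v, hv⟩ := v
  have hv1 : ‖v‖ = 1 := by simpa using hv
  have hv0 : v ≠ 0 := by rw [← norm_pos_iff, hv1]; exact one_pos
  obtain ⟨f, hf, hfa⟩ := isNoetherian_halfRing_iff.1 hM
  obtain ⟨S, c, hc, hSa, ⟨g, hg, hgS⟩, hS⟩ := exists_finset_halfInclusion hv0 hf hfa
  obtain ⟨F, hF⟩ := hM.noetherian ⊤
  -- B bounds the ℓ¹ norm of every `f ∈ S`. Arguments below π/(B + 1) therefore give recurrence sums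
  -- of modulus less than π, and a congruence to 0 modulo 2π becomes an equality.
  let B : ℝ := ∑ f ∈ S, f.coeff.sum fun _ c => |(c : ℝ)|
  have hsum (f : AddMonoidAlgebra ℤ (halfLattice v)) :
      0 ≤ f.coeff.sum fun _ c => |(c : ℝ)| := Finset.sum_nonneg fun _ _ => abs_nonneg _
  have hB : 0 ≤ B := Finset.sum_nonneg fun f _ => hsum f
  obtain ⟨δ, hδ, harg⟩ := exists_dist_one_lt_imp_abs_arg_lt
    (show 0 < Real.pi / (B + 1) from div_pos Real.pi_pos (by linarith))
  refine ⟨F, δ, hδ, fun x hx => DualSpace.eq_one_of_span hF fun m hm => ?_⟩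
  let y : halfLattice v → ℝ := fun n => argAlong x m (n : Fin d → ℤ)
  have hy (n : halfLattice v) : |y n| < Real.pi / (B + 1) := harg _ (hx n n.2 m hm)
  have hrel : ∀ f ∈ S, ∀ n, (f.coeff.sum fun j c => (c : ℝ) * y (n + j)) = 0 := by
    intro f hfS n
    refine eq_zero_of_exp_eq_one ?_ ?_
    · refine (exp_sum_argAlong x m f n).trans ?_
      rw [Module.mem_annihilator.1 (hSa f hfS), smul_zero, DualSpace.apply_zero]
    · calc |f.coeff.sum fun j c => (c : ℝ) * y (n + j)|
          ≤ ∑ j ∈ f.coeff.support, |(f.coeff j : ℝ) * y (n + j)| := Finset.abs_sum_le_sum_abs _ _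
        _ ≤ ∑ j ∈ f.coeff.support, |(f.coeff j : ℝ)| * (Real.pi / (B + 1)) := by
          refine Finset.sum_le_sum fun j _ => ?_
          rw [abs_mul]
          gcongr
          exact (hy _).le
        _ ≤ B * (Real.pi / (B + 1)) := by
          rw [← Finset.sum_mul]
          refine mul_le_mul_of_nonneg_right ?_ (div_pos Real.pi_pos (by linarith)).le
          exact Finset.single_le_sum
            (f := fun f : AddMonoidAlgebra ℤ (halfLattice v) => f.coeff.sum fun _ c => |(c : ℝ)|)
            (fun f _ => hsum f) hfS
        _ < Real.pi := by
          rw [mul_div_assoc', div_lt_iff₀ (by linarith)]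
          nlinarith [Real.pi_pos]
  have hy0 : ∀ n, y n = 0 := by
    by_contra! hne
    obtain ⟨n₀, hn₀⟩ := hne
    obtain ⟨χ, hχ1, hχS⟩ := exists_bounded_character (S : Set (AddMonoidAlgebra ℤ (halfLattice v)))
      (fun n => (y n : ℂ)) (Real.pi / (B + 1))
      (fun n => by rw [Complex.norm_real]; exact (hy n).le)
      (fun h => hn₀ (Complex.ofReal_eq_zero.1 (congrFun h n₀)))
      (fun f hf n => by
        rw [← Complex.ofReal_zero, ← hrel f hf n]
        simp [Finsupp.sum])
    obtain ⟨z, hz⟩ := exists_powChar_extending hv0 χ (character_ne_zero hc hg (hχS _ hgS))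
    have heval (f : AddMonoidAlgebra ℤ (halfLattice v)) :
        evalHom z (halfInclusion v f) = AddMonoidAlgebra.lift ℤ ℂ _ χ f := by
      induction f using AddMonoidAlgebra.induction_linear with
      | zero => simp
      | add f g hf hg => rw [map_add, map_add, map_add, hf, hg]
      | single n c =>
        rw [halfInclusion_single, map_zsmul, evalHom_monom, hz, AddMonoidAlgebra.lift_single]
    have hzV : z ∈ variety (Module.annihilator (LaurentRing d) M) :=
      hS z fun f hf => (heval f).trans (hχS f hf)
    have hray : logAbs z ∈ ray v := by
      refine mem_ray_of_height_nonpos hv1 fun n hn => ?_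
      rw [← Real.exp_le_one_iff, ← norm_powChar, hz ⟨n, hn⟩]
      exact hχ1 _
    exact Set.eq_empty_iff_forall_notMem.1 hV _ ⟨hray, z, hzV, rfl⟩
  intro n hn
  rw [← exp_argAlong, show argAlong x m n = 0 from hy0 ⟨n, hn⟩, Circle.exp_zero]

theorem characterExpansive_iff [IsNoetherian (LaurentRing d) M]
    {v : Metric.sphere (0 : EuclideanSpace ℝ (Fin d)) 1} :
    CharacterExpansive M (v : EuclideanSpace ℝ (Fin d)) ↔
      IsNoetherian (halfRing (halfSpace v)) M ∧
        ray (v : EuclideanSpace ℝ (Fin d)) ∩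
          logVariety (Module.annihilator (LaurentRing d) M) = ∅ := by
  refine ⟨fun h => ⟨?_, h.ray_inter_logVariety⟩,
    fun h => characterExpansive_of_ray_inter_logVariety h.1 h.2⟩
  have := h.finite
  exact isNoetherian_halfRing_iff.2 exists_leadingOne_of_finite

end Sufficiency

/-! ### Reduction from the annihilator to associated primes -/

section AssociatedPrimes

variable {d : ℕ} {M : Type*} [AddCommGroup M] [Module (LaurentRing d) M]

lemma annihilator_le_of_mem_associatedPrimes {p : Ideal (LaurentRing d)}
    (hp : p ∈ associatedPrimes (LaurentRing d) M) :
    Module.annihilator (LaurentRing d) M ≤ p := by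
  obtain ⟨-, m, hm⟩ := (mem_associatedPrimes_iff d M p).1 hp
  exact fun f hf => (hm f).2 (Module.mem_annihilator.1 hf m)

variable [IsNoetherian (LaurentRing d) M]

lemma exists_associatedPrime_le {q : Ideal (LaurentRing d)} [q.IsPrime]
    (hq : Module.annihilator (LaurentRing d) M ≤ q) :
    ∃ p ∈ associatedPrimes (LaurentRing d) M, p ≤ q := by
  obtain ⟨p, hp, hpq⟩ := Ideal.exists_minimalPrimes_le hq
  exact ⟨p, Module.associatedPrimes.minimalPrimes_annihilator_subset_associatedPrimes _ _ hp, hpq⟩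

theorem isNoetherian_halfRing_iff_associatedPrimes
    {v : Metric.sphere (0 : EuclideanSpace ℝ (Fin d)) 1} :
    IsNoetherian (halfRing (halfSpace v)) M ↔
      ∀ p ∈ associatedPrimes (LaurentRing d) M,
        IsNoetherian (halfRing (halfSpace v)) (LaurentRing d ⧸ p) := by
  simp only [isNoetherian_halfRing_iff, Ideal.annihilator_quotient]
  constructor
  · rintro ⟨f, hf, hfM⟩ p hp
    exact ⟨f, hf, annihilator_le_of_mem_associatedPrimes hp hfM⟩
  · intro h
    choose! f hf hfp using h
    have hfin := associatedPrimes.finite (LaurentRing d) M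
    -- Every prime over the annihilator contains an associated prime p, hence the factor `f p`. A
    -- power of the product then lies in the annihilator, and `leadingOne` is closed under products.
    have hrad : ∏ p ∈ hfin.toFinset, f p ∈ (Module.annihilator (LaurentRing d) M).radical := by
      rw [Ideal.radical_eq_sInf, Submodule.mem_sInf]
      rintro q ⟨hq, hqp⟩
      obtain ⟨p, hp, hpq⟩ := exists_associatedPrime_le hq
      exact Ideal.mem_of_dvd q (Finset.dvd_prod_of_mem f (hfin.mem_toFinset.2 hp)) (hpq (hfp p hp))
    obtain ⟨n, hn⟩ := hrad
    exact ⟨_, pow_mem (prod_mem fun p hp => hf p (hfin.mem_toFinset.1 hp)) n, hn⟩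

theorem inter_logVariety_annihilator_eq_empty_iff {s : Set (EuclideanSpace ℝ (Fin d))} :
    s ∩ logVariety (Module.annihilator (LaurentRing d) M) = ∅ ↔
      ∀ p ∈ associatedPrimes (LaurentRing d) M, s ∩ logVariety p = ∅ := by
  simp only [Set.eq_empty_iff_forall_notMem]
  constructor
  · rintro h p hp _ ⟨hs, z, hz, rfl⟩
    exact h _ ⟨hs, z, fun f hf => hz f (annihilator_le_of_mem_associatedPrimes hp hf), rfl⟩
  · rintro h _ ⟨hs, z, hz, rfl⟩
    have : (RingHom.ker (evalHom z)).IsPrime := RingHom.ker_isPrime _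
    obtain ⟨p, hp, hpz⟩ := exists_associatedPrime_le (mem_variety_iff.1 hz)
    exact h p hp _ ⟨hs, z, mem_variety_iff.2 hpz, rfl⟩

end AssociatedPrimes

end AlgAction

end

theorem theorem4p8 (d : ℕ) (M : Type*) [AddCommGroup M] [Module (AlgAction.LaurentRing d) M]
    [IsNoetherian (AlgAction.LaurentRing d) M]
    (v : Metric.sphere (0 : EuclideanSpace ℝ (Fin d)) 1)
    (ρ : AlgAction.CompatibleMetric (AlgAction.DualSpace M))
    (ρq : ∀ p : Ideal (AlgAction.LaurentRing d),
      AlgAction.CompatibleMetric (AlgAction.DualSpace (AlgAction.LaurentRing d ⧸ p))) :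
    List.TFAE [
      AlgAction.IsExpansiveAlong ρ (AlgAction.dualAction d M) (AlgAction.halfSpace v),
      ∀ p ∈ associatedPrimes (AlgAction.LaurentRing d) M,
        AlgAction.IsExpansiveAlong (ρq p)
          (AlgAction.dualAction d (AlgAction.LaurentRing d ⧸ p)) (AlgAction.halfSpace v),
      ∀ p ∈ associatedPrimes (AlgAction.LaurentRing d) M,
        IsNoetherian (AlgAction.halfRing (AlgAction.halfSpace v))
            (AlgAction.LaurentRing d ⧸ p) ∧
          AlgAction.ray (v : EuclideanSpace ℝ (Fin d)) ∩ AlgAction.logVariety p = ∅] := by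
  tfae_have 1 ↔ 3 := by
    rw [AlgAction.isExpansiveAlong_iff, AlgAction.characterExpansive_iff,
      AlgAction.isNoetherian_halfRing_iff_associatedPrimes,
      AlgAction.inter_logVariety_annihilator_eq_empty_iff]
    exact ⟨fun h p hp => ⟨h.1 p hp, h.2 p hp⟩,
      fun h => ⟨fun p hp => (h p hp).1, fun p hp => (h p hp).2⟩⟩
  -- The same criterion applied to R_d/p, whose annihilator is p.
  tfae_have 2 ↔ 3 := by
    refine forall₂_congr fun p _ => ?_
    rw [AlgAction.isExpansiveAlong_iff, AlgAction.characterExpansive_iff,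
      Ideal.annihilator_quotient]
  tfae_finish
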